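/- Let $\alpha\in(0,1)$ and $\beta\in(0,1]$ with $\alpha\beta>\tfrac12$, and let $(B^{\alpha,\beta}(t))_{t\ge 0}$ be a bifractional Brownian motion on a probability space, i.e. a centred real Gaussian process with covariance function $$R(s,t)=\frac1{2^{\beta}}\Big((t^{2\alpha}+s^{2\alpha})^{\beta}-|t-s|^{2\alpha\beta}\Big),\qquad s,t\ge 0,$$ such that almost every sample path $t\mapsto B^{\alpha,\beta}(t)$ is continuous on $[0,1]$. Let $\mathcal E$ be the linear space generated by the indicator functions $\mathbf 1_{[0,t]}$, $t\in[0,1]$, with the (possibly degenerate) inner product determined by $\langle \mathbf 1_{[0,t]},\mathbf 1_{[0,s]}\rangle_{\mathcal H}=R(s,t)$, let $\mathcal H$ be its Hausdorff completion, and let $\varphi\mapsto B^{\alpha,\beta}(\varphi)$ be the Wiener integral, i.e. the linear isometry from $\mathcal H$ to $L^2(\mathbb P)$ that extends $\mathbf 1_{[0,t]}\mapsto B^{\alpha,\beta}(t)$. For $1\le p<\infty$, $\gamma>0$ and $f:[0,1]\to\mathbb R$ put $$\|f\|_{\gamma,p}=\|f\|_{L^p([0,1])}+\sup_{0<t\le1}t^{-\gamma}\sup_{|s|\le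 t}\Big(\int_{\{x\in[0,1]:\,x+s\in[0,1]\}}|f(x+s)-f(x)|^p\,dx\Big)^{1/p},$$ and let $\mathbf{Bes}(\gamma,p)=\{f\in L^p([0,1]):\|f\|_{\gamma,p}<\infty\}$, with this norm. **Theorem.** Let $(\varphi_n)_{n\ge1}$ be an orthonormal basis of $\mathcal H$. Then, almost surely, for all $\varepsilon>0$ and $p\ge 1$ (real) with $\tfrac12<\alpha\beta-\varepsilon-\tfrac1p$, the functions $$t\mapsto\sum_{n=1}^{N}\langle\varphi_n,\mathbf 1_{[0,t]}\rangle_{\mathcal H}\,B^{\alpha,\beta}(\varphi_n),\qquad N\ge 0,$$ and the sample path $t\mapsto B^{\alpha,\beta}(t)$, $t\in[0,1]$, belong to $\mathbf{Bes}(\alpha\beta-\varepsilon,p)$, and $$\sum_{n=1}^{N}\langle\varphi_n,\mathbf 1_{[0,\cdot]}\rangle_{\mathcal H}\,B^{\alpha,\beta}(\varphi_n)\ \underset{N\to\infty}{\longrightarrow}\ B^{\alpha,\beta}(\cdot)\qquad\text{in }\mathbf{Bes}(\alpha\beta-\varepsilon,p).$$ -/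

import Mathlib

open MeasureTheory ProbabilityTheory Filter Topology Set
open scoped NNReal ENNReal unitInterval

noncomputable section

namespace BifractionalBM

/-! ### The process -/

/-- The covariance function `R(s,t) = 2^{-β} ((t^{2α} + s^{2α})^β - |t - s|^{2αβ})`. -/
def covFun (α β s t : ℝ) : ℝ :=
  1 / 2 ^ β * ((t ^ (2 * α) + s ^ (2 * α)) ^ β - |t - s| ^ (2 * α * β))

/-- `B = (B(t))_{t ≥ 0}` is a bifractional Brownian motion with parameters `α, β`: a centred real
Gaussian process with covariance function `R`. Nothing is required of the sample paths here. -/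
structure IsBifractionalBM {Ω : Type*} [MeasurableSpace Ω] (α β : ℝ) (B : ℝ≥0 → Ω → ℝ)
    (P : Measure Ω) : Prop where
  isGaussianProcess : IsGaussianProcess B P
  centred : ∀ t, ∫ ω, B t ω ∂P = 0
  covariance_eq : ∀ s t : ℝ≥0, cov[B s, B t; P] = covFun α β s t

/-! ### The step functions -/

/-- The indicator function `1_{[0,t]}`, for `t ∈ [0,1]`. -/
def indicatorFn (t : I) : ℝ → ℝ := (Icc (0 : ℝ) t).indicator 1

theorem linearIndependent_indicatorFn : LinearIndependent ℝ indicatorFn := by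
  classical
  rw [linearIndependent_iff']
  intro s c hsum
  by_contra! hne
  obtain ⟨i₀, hi₀, hc₀⟩ := hne
  set T := s.filter fun i => c i ≠ 0 with hT
  have hTne : T.Nonempty := ⟨i₀, by simp [hT, hi₀, hc₀]⟩
  set m := T.max' hTne with hm
  have hmT : m ∈ T := T.max'_mem hTne
  have hms : m ∈ s := (Finset.mem_filter.1 hmT).1
  have hcm : c m ≠ 0 := (Finset.mem_filter.1 hmT).2
  have h := congrFun hsum (m : ℝ)
  rw [Finset.sum_apply, Finset.sum_eq_single m] at h
  · have h1 : indicatorFn m (m : ℝ) = 1 := by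
      simp [indicatorFn, m.2.1]
    simp [h1] at h
    exact hcm h
  · intro i hi him
    by_cases hci : c i = 0
    · simp [hci]
    · have hiT : i ∈ T := Finset.mem_filter.2 ⟨hi, hci⟩
      have hlt : (i : ℝ) < m := lt_of_le_of_ne (T.le_max' i hiT) fun h => him (Subtype.ext h)
      simp [indicatorFn, hlt.not_ge]
  · intro hnot
    exact absurd hms hnot

/-- The linear space generated by the functions `1_{[0,t]}`, `t ∈ [0,1]`. -/
def stepFunctions : Submodule ℝ (ℝ → ℝ) := Submodule.span ℝ (range indicatorFn)

/-- The unique coefficients `(a_t)` of a step function `∑ a_t 1_{[0,t]}`. -/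
def coeff : stepFunctions →ₗ[ℝ] I →₀ ℝ := linearIndependent_indicatorFn.repr

/-- The sum `∑_{s,t} a_s b_t R(s,t)`. -/
def covForm (α β : ℝ) (a b : I →₀ ℝ) : ℝ :=
  a.sum fun s x => b.sum fun t y => x * y * covFun α β s t

/-- The kernel `R` is positive semidefinite on `[0,1]`. -/
def IsPosSemidef (α β : ℝ) : Prop := ∀ a : I →₀ ℝ, 0 ≤ covForm α β a a

/-! ### The Hilbert space `ℋ` -/

/-- The space `ℰ` of step functions, as a type of its own, to carry the inner product
`⟨1_{[0,s]}, 1_{[0,t]}⟩ = R(s,t)` (and not the topology of pointwise convergence). -/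
def StepSpace (α β : ℝ) (_hR : IsPosSemidef α β) : Type := stepFunctions

section StepSpace

variable {α β : ℝ} {hR : IsPosSemidef α β}

instance : AddCommGroup (StepSpace α β hR) := inferInstanceAs (AddCommGroup stepFunctions)

instance : Module ℝ (StepSpace α β hR) := inferInstanceAs (Module ℝ stepFunctions)

/-- The coefficients, as a linear map on `ℰ`. -/
def StepSpace.coeff : StepSpace α β hR →ₗ[ℝ] I →₀ ℝ := BifractionalBM.coeff

/-- The element `1_{[0,t]}` of `ℰ`. -/
def StepSpace.ind (t : I) : StepSpace α β hR :=
  (⟨indicatorFn t, Submodule.subset_span (mem_range_self t)⟩ : stepFunctions)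

theorem StepSpace.coeff_ind (t : I) :
    StepSpace.coeff (StepSpace.ind t : StepSpace α β hR) = Finsupp.single t 1 :=
  linearIndependent_indicatorFn.repr_eq_single t _ rfl

theorem covFun_comm (s t : ℝ) : covFun α β s t = covFun α β t s := by
  unfold covFun
  rw [abs_sub_comm, add_comm]

theorem covForm_comm (a b : I →₀ ℝ) : covForm α β a b = covForm α β b a := by
  unfold covForm
  simp only [Finsupp.sum]
  rw [Finset.sum_comm]
  refine Finset.sum_congr rfl fun t _ => Finset.sum_congr rfl fun s _ => ?_
  rw [covFun_comm, mul_comm (a s)]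

theorem covForm_add_left (a a' b : I →₀ ℝ) :
    covForm α β (a + a') b = covForm α β a b + covForm α β a' b := by
  unfold covForm
  refine Finsupp.sum_add_index' (fun s => ?_) fun s x x' => ?_
  · simp
  · simp [add_mul, Finsupp.sum_add]

theorem covForm_smul_left (r : ℝ) (a b : I →₀ ℝ) :
    covForm α β (r • a) b = r * covForm α β a b := by
  unfold covForm
  rw [Finsupp.sum_smul_index' (fun s => by simp)]
  simp only [Finsupp.sum, Finset.mul_sum, smul_eq_mul, mul_assoc]

/-- The (possibly degenerate) inner product on `ℰ` that extends
`⟨1_{[0,s]}, 1_{[0,t]}⟩ = R(s,t)` bilinearly. -/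
@[reducible]
def stepCore (α β : ℝ) (hR : IsPosSemidef α β) :
    PreInnerProductSpace.Core ℝ (StepSpace α β hR) where
  inner f g := covForm α β (StepSpace.coeff f) (StepSpace.coeff g)
  conj_inner_symm f g := by simpa using covForm_comm _ _
  re_inner_nonneg f := by simpa using hR _
  add_left f g h := by rw [map_add, covForm_add_left]
  smul_left f g r := by rw [map_smul, covForm_smul_left]; simp

instance : SeminormedAddCommGroup (StepSpace α β hR) :=
  @InnerProductSpace.Core.toSeminormedAddCommGroup ℝ _ _ _ _ (stepCore α β hR)

instance : InnerProductSpace ℝ (StepSpace α β hR) := InnerProductSpace.ofCore (stepCore α β hR)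

theorem StepSpace.inner_def (f g : StepSpace α β hR) :
    inner ℝ f g = covForm α β (StepSpace.coeff f) (StepSpace.coeff g) := rfl

theorem StepSpace.inner_ind (s t : I) :
    inner ℝ (StepSpace.ind s : StepSpace α β hR) (StepSpace.ind t) = covFun α β s t := by
  simp [StepSpace.inner_def, StepSpace.coeff_ind, covForm]

end StepSpace

/-- The Hilbert space `ℋ`: the (Hausdorff) completion of `ℰ`. -/
abbrev HSpace (α β : ℝ) (hR : IsPosSemidef α β) : Type :=
  UniformSpace.Completion (StepSpace α β hR)

/-- The element `1_{[0,t]}` of `ℋ`. -/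
def ind {α β : ℝ} (hR : IsPosSemidef α β) (t : I) : HSpace α β hR :=
  ((StepSpace.ind t : StepSpace α β hR) : UniformSpace.Completion (StepSpace α β hR))

theorem inner_ind_ind {α β : ℝ} (hR : IsPosSemidef α β) (s t : I) :
    inner ℝ (ind hR s) (ind hR t) = covFun α β s t := by
  rw [ind, ind, UniformSpace.Completion.inner_coe, StepSpace.inner_ind]

/-! ### The Wiener integral -/

section Wiener

variable {Ω : Type*} [MeasurableSpace Ω] {α β : ℝ} {B : ℝ≥0 → Ω → ℝ} {P : Measure Ω}

theorem IsBifractionalBM.memLp (hB : IsBifractionalBM α β B P) (t : ℝ≥0) : MemLp (B t) 2 P :=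
  (hB.isGaussianProcess.hasGaussianLaw_eval t).memLp_two

/-- `B(t)` as an element of `L²(P)`. -/
def IsBifractionalBM.toL2 (hB : IsBifractionalBM α β B P) (t : I) : Lp ℝ 2 P :=
  (hB.memLp (unitInterval.toNNReal t)).toLp (B (unitInterval.toNNReal t))

theorem IsBifractionalBM.inner_toL2 (hB : IsBifractionalBM α β B P) (s t : I) :
    inner ℝ (hB.toL2 s) (hB.toL2 t) = covFun α β s t := by
  have h := hB.covariance_eq (unitInterval.toNNReal s) (unitInterval.toNNReal t)
  simp only [covariance, hB.centred, sub_zero, unitInterval.coe_toNNReal] at h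
  rw [← h, L2.inner_def]
  refine integral_congr_ae ?_
  filter_upwards [(hB.memLp (unitInterval.toNNReal s)).coeFn_toLp,
    (hB.memLp (unitInterval.toNNReal t)).coeFn_toLp] with ω h1 h2
  simp only [IsBifractionalBM.toL2, h1, h2]
  simp [mul_comm]

/-- The random variable `∑ a_t B(t)` in `L²(P)`. -/
def IsBifractionalBM.combination (hB : IsBifractionalBM α β B P) : (I →₀ ℝ) →ₗ[ℝ] Lp ℝ 2 P :=
  Finsupp.linearCombination ℝ hB.toL2

theorem IsBifractionalBM.inner_combination (hB : IsBifractionalBM α β B P) (a b : I →₀ ℝ) :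
    inner ℝ (hB.combination a) (hB.combination b) = covForm α β a b := by
  rw [covForm_comm]
  simp only [IsBifractionalBM.combination, Finsupp.linearCombination_apply, Finsupp.sum, covForm,
    sum_inner, inner_sum, real_inner_smul_left, real_inner_smul_right, hB.inner_toL2]
  exact Finset.sum_congr rfl fun s _ => Finset.sum_congr rfl fun t _ => by
    rw [covFun_comm]; ring

/-- The covariance function of a process is positive semidefinite. -/
theorem IsBifractionalBM.isPosSemidef (hB : IsBifractionalBM α β B P) : IsPosSemidef α β := by
  intro a
  rw [← hB.inner_combination]
  exact real_inner_self_nonneg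

/-- The isometry `∑ a_t 1_{[0,t]} ↦ ∑ a_t B(t)` from `ℰ` to `L²(P)`. -/
def IsBifractionalBM.stepIntegral (hB : IsBifractionalBM α β B P) :
    StepSpace α β hB.isPosSemidef →ₗᵢ[ℝ] Lp ℝ 2 P where
  toLinearMap := hB.combination.comp StepSpace.coeff
  norm_map' f := by
    have h : inner ℝ (hB.combination (StepSpace.coeff f)) (hB.combination (StepSpace.coeff f))
        = inner ℝ f f := by
      rw [hB.inner_combination, StepSpace.inner_def]
    rw [real_inner_self_eq_norm_sq, real_inner_self_eq_norm_sq] at h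
    exact (sq_eq_sq₀ (norm_nonneg _) (norm_nonneg _)).1 h

/-- The Wiener integral `φ ↦ B(φ)`: the isometry from `ℋ` to `L²(P)` that extends
`1_{[0,t]} ↦ B(t)`. -/
def IsBifractionalBM.wiener (hB : IsBifractionalBM α β B P) :
    HSpace α β hB.isPosSemidef →ₗᵢ[ℝ] Lp ℝ 2 P where
  toLinearMap := hB.stepIntegral.toContinuousLinearMap.fromCompletion
  norm_map' φ := by
    refine UniformSpace.Completion.induction_on φ (isClosed_eq ?_ continuous_norm) fun f => ?_
    · exact (ContinuousLinearMap.continuous _).norm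
    · simp

theorem IsBifractionalBM.wiener_ind (hB : IsBifractionalBM α β B P) (t : I) :
    hB.wiener (ind hB.isPosSemidef t) =ᵐ[P] B (unitInterval.toNNReal t) := by
  have h : hB.wiener (ind hB.isPosSemidef t) = hB.toL2 t := by
    change hB.stepIntegral.toContinuousLinearMap.fromCompletion
      ((StepSpace.ind t : StepSpace α β hB.isPosSemidef) :
        UniformSpace.Completion (StepSpace α β hB.isPosSemidef)) = _
    rw [ContinuousLinearMap.fromCompletion_apply_coe]
    change hB.combination (StepSpace.coeff (StepSpace.ind t)) = _
    rw [StepSpace.coeff_ind, IsBifractionalBM.combination, Finsupp.linearCombination_single,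
      one_smul]
  rw [h]
  exact (hB.memLp _).coeFn_toLp

/-- The partial sum `t ↦ ∑_{n < N} ⟨φ_n, 1_{[0,t]}⟩ B(φ_n)(ω)`. The terms are indexed from `0`. -/
def IsBifractionalBM.partialSum (hB : IsBifractionalBM α β B P)
    (φ : ℕ → HSpace α β hB.isPosSemidef) (N : ℕ) (ω : Ω) (t : I) : ℝ :=
  ∑ n ∈ Finset.range N, inner ℝ (φ n) (ind hB.isPosSemidef t) * hB.wiener (φ n) ω

end Wiener

/-! ### Besov spaces on `[0,1]` -/

/-- The modulus `Δ_p(f)(t) = sup_{|s| ≤ t} (∫_{I_s} |f(x+s) - f(x)|^p dx)^{1/p}` of a function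
`f` on `I = [0,1]`, where `I_s = {x ∈ I : x + s ∈ I}`. (The values of the extension
`IccExtend` of `f` outside `I` play no role.) -/
def lpModulus (p : ℝ) (f : I → ℝ) (t : ℝ) : ℝ≥0∞ :=
  ⨆ (s : ℝ) (_ : |s| ≤ t),
    eLpNorm (fun x : ℝ => IccExtend zero_le_one f (x + s) - IccExtend zero_le_one f x)
      (ENNReal.ofReal p)
      (volume.restrict {x : ℝ | x ∈ Icc (0 : ℝ) 1 ∧ x + s ∈ Icc (0 : ℝ) 1})

/-- The norm `‖f‖_{γ,p} = ‖f‖_{L^p} + sup_{0 < t ≤ 1} Δ_p(f)(t) / t^γ`, possibly infinite. -/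
def besovNorm (γ p : ℝ) (f : I → ℝ) : ℝ≥0∞ :=
  eLpNorm f (ENNReal.ofReal p) volume +
    ⨆ (t : ℝ) (_ : 0 < t ∧ t ≤ 1), lpModulus p f t / ENNReal.ofReal (t ^ γ)

/-- `f` belongs to the Besov space `Bes(γ,p)` on `[0,1]`. -/
def MemBesov (γ p : ℝ) (f : I → ℝ) : Prop :=
  MemLp f (ENNReal.ofReal p) volume ∧ besovNorm γ p f < ∞

/-- The functions `f_N` converge to `f` in the Besov space `Bes(γ,p)` on `[0,1]`. -/
def TendstoBesov (γ p : ℝ) (f : ℕ → I → ℝ) (g : I → ℝ) : Prop :=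
  (∀ N, MemBesov γ p (f N)) ∧ MemBesov γ p g ∧
    Tendsto (fun N => besovNorm γ p (fun t => f N t - g t)) atTop (𝓝 0)

end BifractionalBM

end

noncomputable section

namespace BifractionalBM

/-! ### Dyadic chaining -/

/-! Everything reduces to Hölder estimates: on an interval of length one a `γ`-Hölder bound
dominates the Besov norm of order `γ` for every `p`.

For `γ < αβ` the paths are `γ`-Hölder with a random constant `K` that is integrable. This is
Kolmogorov's chaining argument, with Gaussian moments of high order `q` summed over dyadic
increments (`lintegral_dyadicSum_lt_top`, `holder_of_dyadic`).

Since orthogonal jointly Gaussian variables are independent, the partial sum `S_N(t)` is the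
conditional expectation of `B(t)` given the first `N` coefficients `B(φ_n)`
(`condExp_eq_expansion`). Conditioning the inequality `B(t) - B(s) ≤ K |t - s|^γ` therefore gives
`S_N(t) - S_N(s) ≤ 𝔼[K | ℱ] |t - s|^γ`. The conditional expectations of `K` converge almost surely
by Lévy's theorem, so they are bounded in `N`: the partial sums are Hölder uniformly in `N`
(`exists_partialSum_holder`).

Lévy's theorem also gives `S_N(t) → B(t)` almost surely for `t` in a countable dense set
(`tendsto_expansion`). With the uniform Hölder bound this becomes uniform convergence, and
interpolating between the two gives convergence in every smaller Hölder order, hence in the Besov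
norm (`tendsto_besovNorm_zero`). -/

theorem floor_two_mul_cases (x : ℝ) (hx : 0 ≤ x) :
    ⌊2 * x⌋₊ = 2 * ⌊x⌋₊ ∨ ⌊2 * x⌋₊ = 2 * ⌊x⌋₊ + 1 := by
  have h1 := Nat.floor_le hx
  have h2 := Nat.lt_floor_add_one x
  have h3 : 2 * ⌊x⌋₊ ≤ ⌊2 * x⌋₊ := Nat.le_floor (by push_cast; linarith)
  have h4 : ⌊2 * x⌋₊ < 2 * ⌊x⌋₊ + 2 := (Nat.floor_lt (by positivity)).2 (by push_cast; linarith)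
  omega

/-- The largest dyadic number of level `k` below `t`. -/
def dyadicFloor (k : ℕ) (t : ℝ) : ℝ := (⌊t * 2 ^ k⌋₊ : ℝ) / 2 ^ k

theorem tendsto_dyadicFloor {t : ℝ} (ht : 0 ≤ t) :
    Tendsto (fun k => dyadicFloor k t) atTop (𝓝 t) := by
  have h := (tendsto_nat_floor_mul_div_atTop (R := ℝ) ht).comp
    (tendsto_pow_atTop_atTop_of_one_lt (one_lt_two (α := ℝ)))
  exact h

section Chaining

variable {f : ℝ → ℝ} {A r : ℝ}

/-- Refining the level by one leaves the dyadic floor in place or moves it by a single step of level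
`k + 1`. -/
theorem abs_sub_dyadicFloor_succ_le (hA : 0 ≤ A) (hr0 : 0 ≤ r)
    (hf : ∀ k j : ℕ, j < 2 ^ k → |f ((j + 1 : ℕ) / 2 ^ k) - f (j / 2 ^ k)| ≤ A * r ^ k)
    {t : ℝ} (ht : t ∈ Icc (0 : ℝ) 1) (k : ℕ) :
    |f (dyadicFloor (k + 1) t) - f (dyadicFloor k t)| ≤ A * r ^ (k + 1) := by
  have e : t * 2 ^ (k + 1) = 2 * (t * 2 ^ k) := by ring
  have hk : dyadicFloor k t = ((2 * ⌊t * 2 ^ k⌋₊ : ℕ) : ℝ) / 2 ^ (k + 1) := by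
    unfold dyadicFloor; push_cast; rw [pow_succ]; field_simp
  have hnn : 0 ≤ t * 2 ^ k := mul_nonneg ht.1 (by positivity)
  rw [hk]
  unfold dyadicFloor
  rcases floor_two_mul_cases (t * 2 ^ k) hnn with h | h
  · rw [e, h, sub_self, abs_zero]; positivity
  · rw [e, h]
    refine hf _ _ ?_
    have h5 : ⌊2 * (t * 2 ^ k)⌋₊ ≤ 2 ^ (k + 1) := by
      refine Nat.floor_le_of_le ?_
      push_cast
      rw [← e]
      exact mul_le_of_le_one_left (by positivity) ht.2
    omega

/-- The increments along the dyadic floors telescope to `f t` by continuity and are dominated by a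
geometric series. -/
theorem abs_sub_dyadicFloor_le (hA : 0 ≤ A) (hr0 : 0 ≤ r) (hr1 : r < 1) (hcont : Continuous f)
    (hf : ∀ k j : ℕ, j < 2 ^ k → |f ((j + 1 : ℕ) / 2 ^ k) - f (j / 2 ^ k)| ≤ A * r ^ k)
    {t : ℝ} (ht : t ∈ Icc (0 : ℝ) 1) (k : ℕ) :
    |f t - f (dyadicFloor k t)| ≤ A * r ^ k / (1 - r) := by
  have h1 : ∀ n, dist (f (dyadicFloor (k + n) t)) (f (dyadicFloor (k + (n + 1)) t))
      ≤ A * r ^ k * r ^ n := by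
    intro n
    rw [dist_comm, Real.dist_eq]
    refine (abs_sub_dyadicFloor_succ_le hA hr0 hf ht (k + n)).trans ?_
    rw [mul_assoc, ← pow_add]
    exact mul_le_mul_of_nonneg_left (pow_le_pow_of_le_one hr0 hr1.le (Nat.le_succ _)) hA
  have h2 : Tendsto (fun n => f (dyadicFloor (k + n) t)) atTop (𝓝 (f t)) := by
    have := ((hcont.tendsto t).comp (tendsto_dyadicFloor ht.1)).comp (tendsto_add_atTop_nat k)
    refine this.congr fun n => ?_
    simp [add_comm]
  have := dist_le_of_le_geometric_of_tendsto₀ r _ hr1 h1 h2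
  rwa [dist_comm, Real.dist_eq, add_zero] at this

/-- A continuous function whose dyadic increments of level `k` are at most `A 2^{-kγ}` is
`γ`-Hölder continuous. -/
theorem holder_of_dyadic {γ : ℝ} (hγ : 0 < γ) (hA : 0 ≤ A) (hcont : Continuous f)
    (hf : ∀ k j : ℕ, j < 2 ^ k →
      |f ((j + 1 : ℕ) / 2 ^ k) - f (j / 2 ^ k)| ≤ A * ((2 : ℝ) ^ (-γ)) ^ k)
    {s t : ℝ} (hs : s ∈ Icc (0 : ℝ) 1) (ht : t ∈ Icc (0 : ℝ) 1) :
    |f t - f s| ≤ ((2 / (1 - 2 ^ (-γ)) + 1) * 2 ^ γ) * A * |t - s| ^ γ := by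
  wlog hst : s ≤ t generalizing s t
  · rw [abs_sub_comm, abs_sub_comm t]; exact this ht hs (le_of_not_ge hst)
  rcases hst.eq_or_lt with rfl | hlt
  · simp [Real.zero_rpow hγ.ne']
  set r : ℝ := 2 ^ (-γ) with hr
  have hr0 : 0 < r := by positivity
  have hr1 : r < 1 := Real.rpow_lt_one_of_one_lt_of_neg one_lt_two (by linarith)
  have hd : 0 < t - s := sub_pos.2 hlt
  have hd1 : t - s ≤ 1 := by linarith [ht.2, hs.1]
  -- The level with `2^{-(k+1)} < t - s ≤ 2^{-k}`: the dyadic floors of `s` and `t` are then equal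
  -- or adjacent, and `r ^ k` is comparable to `(t - s) ^ γ`.
  obtain ⟨k, hk1, hk2⟩ := exists_nat_pow_near_of_lt_one hd hd1
    (by norm_num : (0 : ℝ) < 1 / 2) (by norm_num)
  have hk1' : 1 / 2 < (t - s) * 2 ^ k := by
    rw [pow_succ, one_div_pow] at hk1
    rw [← div_lt_iff₀ (by positivity)]
    calc _ = 1 / 2 ^ k * (1 / 2) := by ring
      _ < _ := hk1
  have hk2' : (t - s) * 2 ^ k ≤ 1 := by
    rw [one_div_pow] at hk2
    rwa [← le_div_iff₀ (by positivity)]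
  have hrk : r ^ k ≤ 2 ^ γ * (t - s) ^ γ := by
    rw [← Real.mul_rpow (by norm_num) hd.le, hr, ← Real.rpow_natCast, ← Real.rpow_mul (by norm_num),
      mul_comm, Real.rpow_mul (by norm_num), Real.rpow_natCast, Real.rpow_neg (by positivity),
      ← Real.inv_rpow (by positivity)]
    refine Real.rpow_le_rpow (by positivity) ?_ hγ.le
    rw [inv_le_iff_one_le_mul₀ (by positivity)]
    linarith
  have hmid : |f (dyadicFloor k t) - f (dyadicFloor k s)| ≤ A * r ^ k := by
    have h1 : ⌊s * 2 ^ k⌋₊ ≤ ⌊t * 2 ^ k⌋₊ := Nat.floor_mono (by gcongr)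
    have h2 : ⌊t * 2 ^ k⌋₊ < ⌊s * 2 ^ k⌋₊ + 2 := by
      refine (Nat.floor_lt (mul_nonneg ht.1 (by positivity))).2 ?_
      have := Nat.lt_floor_add_one (s * 2 ^ k)
      push_cast
      linarith
    unfold dyadicFloor
    rcases (by omega : ⌊t * 2 ^ k⌋₊ = ⌊s * 2 ^ k⌋₊ ∨ ⌊t * 2 ^ k⌋₊ = ⌊s * 2 ^ k⌋₊ + 1) with h | h
    · rw [h, sub_self, abs_zero]; positivity
    · rw [h]
      refine hf _ _ ?_
      have h5 : ⌊t * 2 ^ k⌋₊ ≤ 2 ^ k := by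
        refine Nat.floor_le_of_le ?_
        push_cast
        exact mul_le_of_le_one_left (by positivity) ht.2
      omega
  have e1 := abs_sub_dyadicFloor_le hA hr0.le hr1 hcont hf ht k
  have e2 := abs_sub_dyadicFloor_le hA hr0.le hr1 hcont hf hs k
  have hq : 0 < 1 - r := by linarith
  calc |f t - f s| = |(f t - f (dyadicFloor k t)) + (f (dyadicFloor k t) - f (dyadicFloor k s))
        - (f s - f (dyadicFloor k s))| := by ring_nf
    _ ≤ A * r ^ k / (1 - r) + A * r ^ k + A * r ^ k / (1 - r) :=
      (abs_sub _ _).trans (add_le_add ((abs_add_le _ _).trans (add_le_add e1 hmid)) e2)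
    _ = (2 / (1 - r) + 1) * A * r ^ k := by ring
    _ ≤ (2 / (1 - r) + 1) * A * (2 ^ γ * (t - s) ^ γ) := by gcongr
    _ = _ := by rw [abs_of_pos hd]; ring

end Chaining

/-! ### Hölder functions and Besov norms -/

section Besov

variable {γ p η M : ℝ} {g : I → ℝ}

/-- The domain of integration has measure at most one, so the sup bound on the increment bounds its
`L^p` norm for every `p`. -/
theorem lpModulus_le_of_holder (hγ : 0 ≤ γ) (hM : 0 ≤ M)
    (hg : ∀ x y : I, |g x - g y| ≤ M * |(x : ℝ) - y| ^ γ) {t : ℝ} :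
    lpModulus p g t ≤ ENNReal.ofReal (M * t ^ γ) := by
  refine iSup₂_le fun s hs => ?_
  set S : Set ℝ := {x : ℝ | x ∈ Icc (0 : ℝ) 1 ∧ x + s ∈ Icc (0 : ℝ) 1} with hS
  have hSm : MeasurableSet S :=
    measurableSet_Icc.inter ((measurable_id.add_const s) measurableSet_Icc)
  have hvol : (volume.restrict S) univ ≤ 1 := by
    rw [Measure.restrict_apply_univ]
    refine (measure_mono (fun x hx => hx.1 : S ⊆ Icc 0 1)).trans ?_
    simp
  have hb : ∀ᵐ x ∂(volume.restrict S),
      ‖IccExtend zero_le_one g (x + s) - IccExtend zero_le_one g x‖ ≤ M * t ^ γ := by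
    refine (ae_restrict_iff' hSm).2 (Eventually.of_forall fun x hx => ?_)
    rw [IccExtend_of_mem _ _ hx.1, IccExtend_of_mem _ _ hx.2, Real.norm_eq_abs]
    refine (hg _ _).trans ?_
    gcongr
    simpa using hs
  refine (eLpNorm_le_of_ae_bound hb).trans ?_
  refine mul_le_of_le_one_left zero_le (ENNReal.rpow_le_one hvol (by positivity))

theorem besovNorm_le_of_holder (hγ : 0 ≤ γ) (hM : 0 ≤ M)
    (hη : ∀ x, |g x| ≤ η) (hg : ∀ x y : I, |g x - g y| ≤ M * |(x : ℝ) - y| ^ γ) :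
    besovNorm γ p g ≤ ENNReal.ofReal η + ENNReal.ofReal M := by
  refine add_le_add ?_ (iSup₂_le fun t ht => ?_)
  · refine (eLpNorm_le_of_ae_bound (Eventually.of_forall hη)).trans ?_
    simp
  · have htp : 0 < t ^ γ := Real.rpow_pos_of_pos ht.1 γ
    rw [ENNReal.div_le_iff (by simpa using htp) ENNReal.ofReal_ne_top, ← ENNReal.ofReal_mul hM]
    exact lpModulus_le_of_holder hγ hM hg

theorem continuous_of_holder (hγ : 0 < γ)
    (hg : ∀ x y : I, |g x - g y| ≤ M * |(x : ℝ) - y| ^ γ) : Continuous g := by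
  refine continuous_iff_continuousAt.2 fun y => tendsto_iff_dist_tendsto_zero.2 ?_
  have h : Tendsto (fun x : I => M * |(x : ℝ) - y| ^ γ) (𝓝 y) (𝓝 0) := by
    have hc : Continuous fun x : I => M * |(x : ℝ) - y| ^ γ :=
      continuous_const.mul ((by fun_prop : Continuous fun x : I => |(x : ℝ) - y|).rpow_const
        fun _ => Or.inr hγ.le)
    simpa [Real.zero_rpow hγ.ne'] using hc.tendsto y
  exact squeeze_zero (fun _ => dist_nonneg) (fun x => by rw [Real.dist_eq]; exact hg x y) h

/-- A `γ'`-Hölder function is `γ`-Hölder for `γ ≤ γ'`. -/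
theorem holder_mono {γ' : ℝ} (hγ : 0 ≤ γ) (hγγ : γ ≤ γ') (hM : 0 ≤ M)
    (hg : ∀ x y : I, |g x - g y| ≤ M * |(x : ℝ) - y| ^ γ') (x y : I) :
    |g x - g y| ≤ M * |(x : ℝ) - y| ^ γ := by
  refine (hg x y).trans (mul_le_mul_of_nonneg_left ?_ hM)
  have h1 : |(x : ℝ) - y| ≤ 1 := by
    rw [abs_le]; constructor <;> linarith [x.2.1, x.2.2, y.2.1, y.2.2]
  exact Real.rpow_le_rpow_of_exponent_ge_of_imp (abs_nonneg _) h1 hγγ (fun _ h => by linarith)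

theorem memBesov_of_holder (hγ : 0 < γ) (hM : 0 ≤ M)
    (hg : ∀ x y : I, |g x - g y| ≤ M * |(x : ℝ) - y| ^ γ) : MemBesov γ p g := by
  have hc := continuous_of_holder hγ hg
  obtain ⟨C, hC⟩ := isCompact_univ.exists_bound_of_continuousOn hc.continuousOn
  refine ⟨?_, (besovNorm_le_of_holder hγ.le hM (fun x => hC x (mem_univ x)) hg).trans_lt ?_⟩
  · exact MemLp.of_bound hc.aestronglyMeasurable C (Eventually.of_forall fun x => hC x (mem_univ x))
  · exact ENNReal.add_lt_top.2 ⟨ENNReal.ofReal_lt_top, ENNReal.ofReal_lt_top⟩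

/-- Interpolation between a uniform bound and a Hölder bound. -/
theorem holder_interpolate {γ' : ℝ} (hγ : 0 < γ) (hγγ : γ ≤ γ') (hM : 0 ≤ M)
    (hη : ∀ x, |g x| ≤ η) (hg : ∀ x y : I, |g x - g y| ≤ M * |(x : ℝ) - y| ^ γ') (x y : I) :
    |g x - g y| ≤ (2 * η) ^ (1 - γ / γ') * M ^ (γ / γ') * |(x : ℝ) - y| ^ γ := by
  have hγ' : 0 < γ' := hγ.trans_le hγγ
  have h0 : 0 ≤ |g x - g y| := abs_nonneg _
  have h2 : |g x - g y| ≤ 2 * η := (abs_sub _ _).trans (by linarith [hη x, hη y])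
  have hθ : 0 < γ / γ' := by positivity
  have hθ1 : 0 ≤ 1 - γ / γ' := sub_nonneg.2 ((div_le_one hγ').2 hγγ)
  calc |g x - g y| = |g x - g y| ^ (1 - γ / γ') * |g x - g y| ^ (γ / γ') := by
        rw [← Real.rpow_add' h0 (by simp)]; simp
    _ ≤ (2 * η) ^ (1 - γ / γ') * (M * |(x : ℝ) - y| ^ γ') ^ (γ / γ') :=
        mul_le_mul (Real.rpow_le_rpow h0 h2 hθ1) (Real.rpow_le_rpow h0 (hg x y) hθ.le)
          (by positivity) (Real.rpow_nonneg (h0.trans h2) _)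
    _ = _ := by
        rw [Real.mul_rpow hM (by positivity), ← Real.rpow_mul (abs_nonneg _),
          mul_div_cancel₀ _ hγ'.ne', mul_assoc]

/-- A uniformly Hölder sequence which tends to zero on a dense set tends to zero uniformly. -/
theorem tendstoUniformly_zero_of_holder (hγ : 0 < γ) {D : Set I} (hD : Dense D) {G : ℕ → I → ℝ}
    (hG : ∀ n, ∀ x y : I, |G n x - G n y| ≤ M * |(x : ℝ) - y| ^ γ)
    (hlim : ∀ x ∈ D, Tendsto (fun n => G n x) atTop (𝓝 0)) {δ : ℝ} (hδ : 0 < δ) :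
    ∀ᶠ n in atTop, ∀ x, |G n x| ≤ δ := by
  have hloc : ∀ y : I, ∃ U ∈ 𝓝 y, ∀ᶠ n in atTop, ∀ x ∈ U, |G n x| ≤ δ := by
    intro y
    have hc : Continuous fun z : I × I => M * |(z.1 : ℝ) - z.2| ^ γ :=
      continuous_const.mul ((by fun_prop : Continuous fun z : I × I => |(z.1 : ℝ) - z.2|).rpow_const
        fun _ => Or.inr hγ.le)
    have hev : ∀ᶠ z in 𝓝 (y, y), M * |(z.1 : ℝ) - z.2| ^ γ < δ / 2 :=
      hc.continuousAt.eventually_lt continuousAt_const (by simp [Real.zero_rpow hγ.ne', hδ])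
    rw [nhds_prod_eq] at hev
    obtain ⟨U, hU, V, hV, hUV⟩ := eventually_prod_iff.1 hev
    obtain ⟨d, hdD, hdV⟩ := (hD.inter_nhds_nonempty hV)
    refine ⟨{x | U x}, hU, ?_⟩
    have := (hlim d hdD).abs
    rw [abs_zero] at this
    filter_upwards [this.eventually_lt_const (half_pos hδ)] with n hn x hx
    have h1 := (hG n x d).trans (hUV hx hdV).le
    have h2 := abs_add_le (G n x - G n d) (G n d)
    rw [sub_add_cancel] at h2
    linarith
  choose U hU hUn using hloc
  obtain ⟨T, hT⟩ := (isCompact_univ (X := I)).elim_nhds_subcover U fun y _ => hU y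
  have : ∀ᶠ n in atTop, ∀ y ∈ T, ∀ x ∈ U y, |G n x| ≤ δ :=
    (Finset.eventually_all T).2 fun y _ => hUn y
  filter_upwards [this] with n hn x
  obtain ⟨y, hy, hxy⟩ := mem_iUnion₂.1 (hT.2 (mem_univ x))
  exact hn y hy x hxy

/-- A sequence which is uniformly `γ'`-Hölder and tends to zero on a dense set tends to zero in the
Besov space of smaller order `γ`. -/
theorem tendsto_besovNorm_zero {γ' : ℝ} (hγ : 0 < γ) (hγγ : γ < γ') (hM : 0 ≤ M) {D : Set I}
    (hD : Dense D) {G : ℕ → I → ℝ}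
    (hG : ∀ n, ∀ x y : I, |G n x - G n y| ≤ M * |(x : ℝ) - y| ^ γ')
    (hlim : ∀ x ∈ D, Tendsto (fun n => G n x) atTop (𝓝 0)) :
    Tendsto (fun n => besovNorm γ p (G n)) atTop (𝓝 0) := by
  have hγ' := hγ.trans hγγ
  have hθ : 0 < 1 - γ / γ' := sub_pos.2 ((div_lt_one hγ').2 hγγ)
  -- The Besov bound obtained by interpolating the sup bound `η` with the Hölder constant `M`. It
  -- vanishes as `η → 0` because `1 - γ / γ' > 0`.
  set F : ℝ → ℝ≥0∞ := fun η =>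
    ENNReal.ofReal η + ENNReal.ofReal ((2 * η) ^ (1 - γ / γ') * M ^ (γ / γ')) with hF
  have hF0 : Tendsto F (𝓝[>] 0) (𝓝 0) := by
    have hc : Continuous F := by
      refine (ENNReal.continuous_ofReal).add (ENNReal.continuous_ofReal.comp ?_)
      exact ((continuous_const.mul continuous_id).rpow_const fun _ => Or.inr hθ.le).mul
        continuous_const
    have := (hc.tendsto 0).mono_left (nhdsWithin_le_nhds (s := Ioi (0 : ℝ)))
    simpa [hF, Real.zero_rpow hθ.ne'] using this
  refine ENNReal.tendsto_nhds_zero.2 fun e he => ?_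
  obtain ⟨δ, hδe, hδ⟩ := ((ENNReal.tendsto_nhds_zero.1 hF0 e he).and self_mem_nhdsWithin).exists
  filter_upwards [tendstoUniformly_zero_of_holder hγ' hD hG hlim hδ] with n hn
  refine (besovNorm_le_of_holder hγ.le ?_ hn
    (holder_interpolate hγ hγγ.le hM hn (hG n))).trans hδe
  have : (0 : ℝ) < δ := hδ
  positivity

end Besov

/-! ### The variance of the increments -/

section Cov

variable {α β : ℝ}

theorem covFun_self (hα : 0 < α) (hβ : 0 < β) {t : ℝ} (ht : 0 ≤ t) :
    covFun α β t t = t ^ (2 * α * β) := by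
  unfold covFun
  rw [sub_self, abs_zero, Real.zero_rpow (by positivity), sub_zero, ← two_mul,
    Real.mul_rpow (by norm_num) (by positivity), ← Real.rpow_mul ht]
  field_simp

/-- Midpoint concavity of `x ↦ x ^ β` at `t ^ (2α)` and `s ^ (2α)` makes the part without `|t - s|`
nonpositive; what remains has the factor `2 / 2 ^ β ≤ 2`. -/
theorem covFun_increment_le (hα : 0 < α) (hβ : β ∈ Ioc (0 : ℝ) 1) {s t : ℝ} (hs : 0 ≤ s)
    (ht : 0 ≤ t) :
    covFun α β t t + covFun α β s s - 2 * covFun α β t s ≤ 2 * |t - s| ^ (2 * (α * β)) := by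
  have hβ0 := hβ.1
  rw [covFun_self hα hβ0 ht, covFun_self hα hβ0 hs]
  have hconc := (Real.concaveOn_rpow hβ0.le hβ.2).2 (x := t ^ (2 * α)) (y := s ^ (2 * α))
    (by simp only [mem_Ici]; positivity) (by simp only [mem_Ici]; positivity)
    (by norm_num : (0 : ℝ) ≤ 1 / 2) (by norm_num : (0 : ℝ) ≤ 1 / 2) (by norm_num)
  simp only [smul_eq_mul, ← Real.rpow_mul ht, ← Real.rpow_mul hs] at hconc
  rw [← mul_add, ← mul_add, Real.mul_rpow (by norm_num) (by positivity),
    Real.div_rpow (by norm_num) (by norm_num), Real.one_rpow] at hconc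
  have h2 : 1 / (2 : ℝ) ^ β ≤ 1 := by
    rw [div_le_one (by positivity)]; exact Real.one_le_rpow one_le_two hβ0.le
  have h3 := mul_le_mul_of_nonneg_right h2
    (Real.rpow_nonneg (abs_nonneg (s - t)) (2 * α * β))
  unfold covFun
  rw [abs_sub_comm t s, ← mul_assoc 2 α β, mul_sub, add_comm (s ^ (2 * α))]
  linarith

theorem norm_ind_sub_sq_le (hα : 0 < α) (hβ : β ∈ Ioc (0 : ℝ) 1) (hR : IsPosSemidef α β)
    (s t : I) : ‖ind hR t - ind hR s‖ ^ 2 ≤ 2 * |(t : ℝ) - s| ^ (2 * (α * β)) := by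
  rw [norm_sub_sq_real, ← real_inner_self_eq_norm_sq, ← real_inner_self_eq_norm_sq,
    inner_ind_ind, inner_ind_ind, inner_ind_ind]
  have := covFun_increment_le hα hβ s.2.1 t.2.1
  linarith

theorem norm_ind_sub_le (hα : 0 < α) (hβ : β ∈ Ioc (0 : ℝ) 1) (hR : IsPosSemidef α β)
    (s t : I) : ‖ind hR t - ind hR s‖ ≤ 2 * |(t : ℝ) - s| ^ (α * β) := by
  refine le_of_sq_le_sq ?_ (by positivity)
  refine (norm_ind_sub_sq_le hα hβ hR s t).trans ?_
  rw [mul_pow, ← Real.rpow_natCast (|_| ^ _), ← Real.rpow_mul (abs_nonneg _),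
    mul_comm (α * β)]
  have : 0 ≤ |(t : ℝ) - s| ^ (2 * (α * β)) := by positivity
  push_cast
  linarith

end Cov

/-! ### Isonormal Gaussian processes -/

section Isonormal

variable {Ω : Type*} [MeasurableSpace Ω] {P : Measure Ω}

/-- The map `X ↦ 𝔼[g(X)]` is continuous on `L²` for a Lipschitz continuous function `g`. -/
theorem continuous_integral_lipschitz [IsProbabilityMeasure P] {g : ℝ → ℂ} {K : ℝ≥0}
    (hg : LipschitzWith K g) : Continuous fun X : Lp ℝ 2 P => ∫ ω, g (X ω) ∂P := by
  have hint : ∀ X : Lp ℝ 2 P, Integrable (fun ω => g (X ω)) P := by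
    intro X
    have hX : Integrable X P := (Lp.memLp X).integrable (by norm_num)
    refine Integrable.mono' (g := fun ω => ‖g 0‖ + K * ‖X ω‖)
      ((integrable_const _).add (hX.norm.const_mul _))
      (hg.continuous.comp_aestronglyMeasurable hX.1) (Eventually.of_forall fun ω => ?_)
    have h1 := hg.dist_le_mul (X ω) 0
    rw [dist_eq_norm, dist_zero_right] at h1
    have h2 := norm_le_norm_add_norm_sub' (g (X ω)) (g 0)
    linarith
  refine (LipschitzWith.of_dist_le_mul (K := K) fun X Y => ?_).continuous
  rw [dist_eq_norm, ← integral_sub (hint X) (hint Y)]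
  have hXY : MemLp (fun ω => X ω - Y ω) 2 P := (Lp.memLp X).sub (Lp.memLp Y)
  calc ‖∫ ω, g (X ω) - g (Y ω) ∂P‖ ≤ ∫ ω, K * ‖X ω - Y ω‖ ∂P := by
        refine norm_integral_le_of_norm_le
          ((hXY.integrable (by norm_num)).norm.const_mul _) (Eventually.of_forall fun ω => ?_)
        simpa [dist_eq_norm] using hg.dist_le_mul (X ω) (Y ω)
    _ = K * ∫ ω, ‖X ω - Y ω‖ ∂P := integral_const_mul _ _
    _ ≤ K * dist X Y := by
        refine mul_le_mul_of_nonneg_left ?_ K.2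
        rw [integral_norm_eq_lintegral_enorm hXY.1, Lp.dist_def, ← eLpNorm_one_eq_lintegral_enorm]
        refine ENNReal.toReal_mono hXY.2.ne ?_
        exact eLpNorm_le_eLpNorm_of_exponent_le (by norm_num) hXY.1

variable {H : Type*} [NormedAddCommGroup H] [InnerProductSpace ℝ H]

/-- The family `W` of random variables is an isonormal Gaussian process. -/
structure IsIsonormal (W : H →ₗᵢ[ℝ] Lp ℝ 2 P) : Prop where
  integral_eq : ∀ h, ∫ ω, W h ω ∂P = 0
  charFun_eq : ∀ h, ∫ ω, Complex.exp (W h ω * Complex.I) ∂P = Complex.exp (-‖h‖ ^ 2 / 2)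

namespace IsIsonormal

variable {W : H →ₗᵢ[ℝ] Lp ℝ 2 P}

theorem integral_mul (W : H →ₗᵢ[ℝ] Lp ℝ 2 P) (h k : H) :
    ∫ ω, W h ω * W k ω ∂P = inner ℝ h k := by
  rw [← W.inner_map_map, L2.inner_def]
  simp [mul_comm]

theorem covariance_eq (hW : IsIsonormal W) (h k : H) : cov[W h, W k; P] = inner ℝ h k := by
  simp only [covariance, hW.integral_eq, sub_zero]
  exact integral_mul W h k

theorem variance_eq (hW : IsIsonormal W) (h : H) : Var[W h; P] = ‖h‖ ^ 2 := by
  rw [← covariance_self (Lp.aestronglyMeasurable _).aemeasurable, hW.covariance_eq,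
    real_inner_self_eq_norm_sq]

theorem map_sum_ae {ι : Type*} (W : H →ₗᵢ[ℝ] Lp ℝ 2 P) (s : Finset ι) (c : ι → ℝ) (h : ι → H) :
    W (∑ i ∈ s, c i • h i) =ᵐ[P] fun ω => ∑ i ∈ s, c i * W (h i) ω := by
  rw [map_sum]
  refine (Lp.coeFn_fun_finsetSum s _).trans ?_
  have : ∀ i ∈ s, ∀ᵐ ω ∂P, W (c i • h i) ω = c i * W (h i) ω := by
    intro i _
    rw [map_smul]
    exact Lp.coeFn_smul _ _
  filter_upwards [(Finset.eventually_all s).2 this] with ω hω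
  exact Finset.sum_congr rfl hω

/-- A linear functional of finitely many `W h` is again some `W k`, by linearity, so its
characteristic function is known. -/
theorem isGaussianProcess [IsProbabilityMeasure P] (hW : IsIsonormal W) :
    IsGaussianProcess (fun h ω => W h ω) P where
  hasGaussianLaw S := by
    classical
    have hm : AEMeasurable (fun ω => S.restrict fun h => W h ω) P :=
      aemeasurable_pi_lambda _ fun i => (Lp.aestronglyMeasurable _).aemeasurable
    rw [hasGaussianLaw_iff_charFunDual_map_eq hm]
    intro L
    set k : H := ∑ i : S, L (Pi.single i 1) • (i : H) with hk
    have hL : (L ∘ fun ω => S.restrict fun h => W h ω) =ᵐ[P] W k := by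
      refine EventuallyEq.trans ?_ (map_sum_ae W _ _ _).symm
      refine Eventually.of_forall fun ω => ?_
      have : (S.restrict fun h => W h ω) = ∑ i : S, W i ω • (Pi.single i (1 : ℝ) : S → ℝ) := by
        ext j
        simp [Finset.sum_apply, Pi.single_apply]
      simp only [Function.comp_apply]
      rw [this, map_sum]
      simp [mul_comm]
    rw [charFunDual_apply, integral_map hm (by fun_prop), variance_congr hL, integral_congr_ae hL,
      hW.integral_eq, hW.variance_eq]
    have : ∫ ω, Complex.exp (L (S.restrict fun h => W h ω) * Complex.I) ∂P
        = ∫ ω, Complex.exp (W k ω * Complex.I) ∂P := by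
      refine integral_congr_ae ?_
      filter_upwards [hL] with ω hω
      simp only [Function.comp_apply] at hω
      rw [hω]
    rw [this, hW.charFun_eq]
    congr 1
    push_cast
    ring

theorem map_eq_gaussianReal [IsProbabilityMeasure P] (hW : IsIsonormal W) (h : H) :
    P.map (W h) = gaussianReal 0 (‖h‖₊ ^ 2) := by
  have := (hW.isGaussianProcess.hasGaussianLaw_eval h).map_eq_gaussianReal
  rw [this]
  have h2 := hW.variance_eq h
  congr 1
  · exact hW.integral_eq h
  · ext
    have h2' : Var[fun ω => W h ω; P] = ‖h‖ ^ 2 := h2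
    rw [h2', Real.coe_toNNReal _ (by positivity)]
    simp

/-- The absolute moments of an isonormal process. -/
theorem lintegral_pow [IsProbabilityMeasure P] (hW : IsIsonormal W) (h : H) (q : ℕ) :
    ∫⁻ ω, ‖W h ω‖ₑ ^ q ∂P = ‖h‖ₑ ^ q * ∫⁻ x, ‖x‖ₑ ^ q ∂(gaussianReal 0 1) := by
  have h1 : ∫⁻ ω, ‖W h ω‖ₑ ^ q ∂P = ∫⁻ x, ‖x‖ₑ ^ q ∂(P.map (W h)) := by
    rw [lintegral_map' (by fun_prop) (Lp.aestronglyMeasurable _).aemeasurable]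
  have h2 : gaussianReal 0 (‖h‖₊ ^ 2) = (gaussianReal 0 1).map (‖h‖ * ·) := by
    rw [gaussianReal_map_const_mul, mul_zero, mul_one]
    congr 1
  rw [h1, hW.map_eq_gaussianReal, h2, lintegral_map (by fun_prop) (by fun_prop),
    ← lintegral_const_mul _ (by fun_prop)]
  simp [enorm_mul, mul_pow]

theorem lintegral_pow_gaussianReal_lt_top (q : ℕ) :
    ∫⁻ x, ‖x‖ₑ ^ q ∂(gaussianReal 0 1) < ∞ := by
  have h := (memLp_id_gaussianReal (μ := 0) (v := 1) q).integrable_norm_pow'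
  have h2 := h.2
  rw [HasFiniteIntegral] at h2
  simpa [enorm_pow] using h2

/-- The partial sums of the expansion of `W h`. -/
def expansion (W : H →ₗᵢ[ℝ] Lp ℝ 2 P) (φ : ℕ → H) (N : ℕ) (h : H) (ω : Ω) : ℝ :=
  ∑ n ∈ Finset.range N, inner ℝ (φ n) h * W (φ n) ω

/-- The filtration generated by the variables `W (φ n)`. -/
def filtration (W : H →ₗᵢ[ℝ] Lp ℝ 2 P) (φ : ℕ → H) : Filtration ℕ ‹MeasurableSpace Ω› :=
  Filtration.natural (fun n ω => W (φ n) ω) fun _ => Lp.stronglyMeasurable _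

theorem expansion_sub (φ : ℕ → H) (N : ℕ) (h k : H) (ω : Ω) :
    expansion W φ N (h - k) ω = expansion W φ N h ω - expansion W φ N k ω := by
  simp [expansion, inner_sub_right, sub_mul]

/-- The `σ`-algebra of index `N` already contains `W (φ N)`, hence the `N + 1` terms. -/
theorem stronglyMeasurable_expansion (φ : ℕ → H) (N : ℕ) (h : H) :
    StronglyMeasurable[filtration W φ N] (expansion W φ (N + 1) h) := by
  unfold expansion
  refine Finset.stronglyMeasurable_fun_sum _ fun n hn => ?_
  refine StronglyMeasurable.const_mul ?_ _
  have h1 := Filtration.stronglyAdapted_natural (u := fun n ω => W (φ n) ω)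
    (fun _ => Lp.stronglyMeasurable _) n
  exact h1.mono ((filtration W φ).mono (Nat.lt_succ_iff.1 (Finset.mem_range.1 hn)))

/-- The partial sums of the expansion are conditional expectations. -/
theorem condExp_eq_expansion [IsProbabilityMeasure P] (hW : IsIsonormal W) {φ : ℕ → H}
    (hφ : Orthonormal ℝ φ) (h : H) (N : ℕ) :
    P[W h | filtration W φ N] =ᵐ[P] expansion W φ (N + 1) h := by
  set c : ℕ → ℝ := fun n => inner ℝ (φ n) h with hc
  -- The remainder of the orthogonal projection: `W k` is uncorrelated with the generators of the
  -- filtration, hence independent of them, and centred.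
  set k : H := h - ∑ n ∈ Finset.range (N + 1), c n • φ n with hk
  have horth : ∀ n ≤ N, inner ℝ (φ n) k = 0 := by
    intro n hn
    rw [hk, inner_sub_right, hφ.inner_right_sum _ (Finset.mem_range.2 (Nat.lt_succ_of_le hn)),
      hc, sub_self]
  have hindep : IndepFun (fun ω (_ : Unit) => W k ω) (fun ω (j : Iic N) => W (φ j) ω) P := by
    refine IsGaussianProcess.indepFun_of_covariance_eq_zero ?_
      (fun _ => (Lp.aestronglyMeasurable _).aemeasurable)
      (fun _ => (Lp.aestronglyMeasurable _).aemeasurable) fun _ j => ?_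
    · have := hW.isGaussianProcess.comp_right
        (Sum.elim (fun _ : Unit => k) (fun j : Iic N => φ j))
      convert! this using 1
      ext x
      rcases x with x | x <;> rfl
    · exact (hW.covariance_eq k (φ j)).trans ((real_inner_comm _ _).trans (horth j j.2))
  have hI : Indep (MeasurableSpace.comap (W k) inferInstance) (filtration W φ N) P := by
    rw [filtration, Filtration.natural_eq_comap]
    have := hindep.comp (measurable_pi_apply ()) measurable_id
    exact this
  have hkm : StronglyMeasurable[MeasurableSpace.comap (W k) inferInstance] (W k) :=
    (comap_measurable (W k)).stronglyMeasurable
  have hle : MeasurableSpace.comap (W k) inferInstance ≤ ‹MeasurableSpace Ω› :=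
    (Lp.stronglyMeasurable (W k)).measurable.comap_le
  have h0 := condExp_indep_eq hle ((filtration W φ).le N) hkm hI
  have hdec : W h =ᵐ[P] expansion W φ (N + 1) h + W k := by
    have h1 : W k = W h - W (∑ n ∈ Finset.range (N + 1), c n • φ n) := by rw [hk, map_sub]
    have h2 := Lp.coeFn_sub (W h) (W (∑ n ∈ Finset.range (N + 1), c n • φ n))
    rw [← h1] at h2
    filter_upwards [h2, map_sum_ae W (Finset.range (N + 1)) c φ] with ω h2 h3
    rw [Pi.add_apply, h2, Pi.sub_apply, h3]
    simp [expansion, hc]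
  have hint : ∀ g, Integrable (W g) P := fun g => (Lp.memLp (W g)).integrable (by norm_num)
  have hintE : Integrable (expansion W φ (N + 1) h) P :=
    integrable_finsetSum _ fun n _ => (hint (φ n)).const_mul _
  refine (condExp_congr_ae hdec).trans ((condExp_add hintE (hint k) _).trans ?_)
  filter_upwards [h0] with ω hω
  rw [Pi.add_apply, hω, hW.integral_eq, add_zero,
    condExp_of_stronglyMeasurable ((filtration W φ).le N) (stronglyMeasurable_expansion φ N h)
      hintE]

/-- The expansion of `W h` along an orthonormal basis converges almost surely. -/
theorem tendsto_expansion [IsProbabilityMeasure P] (hW : IsIsonormal W) (φ : HilbertBasis ℕ ℝ H)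
    (h : H) : ∀ᵐ ω ∂P, Tendsto (fun N => expansion W φ N h ω) atTop (𝓝 (W h ω)) := by
  have hae : ∀ N, W (∑ n ∈ Finset.range N, inner ℝ (φ n) h • φ n) =ᵐ[P] expansion W φ N h :=
    fun N => map_sum_ae W _ _ _
  have hL2 : Tendsto (fun N => W (∑ n ∈ Finset.range N, inner ℝ (φ n) h • φ n)) atTop
      (𝓝 (W h)) := by
    refine (W.continuous.tendsto h).comp ?_
    have := (φ.hasSum_repr h).tendsto_sum_nat
    simpa [HilbertBasis.repr_apply_apply] using this
  -- Lévy's theorem gives an almost sure limit; an almost surely convergent subsequence, from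
  -- convergence in `L²`, identifies it as `W h`.
  obtain ⟨ns, hns, hsub⟩ := (tendstoInMeasure_of_tendsto_Lp hL2).exists_seq_tendsto_ae
  have hlevy := MeasureTheory.tendsto_ae_condExp (μ := P) (ℱ := filtration W φ) (W h)
  have hce := ae_all_iff.2 fun N => hW.condExp_eq_expansion φ.orthonormal h N
  filter_upwards [hsub, hlevy, hce, ae_all_iff.2 hae] with ω h1 h2 h3 h4
  have h5 : Tendsto (fun N => expansion W φ N h ω) atTop
      (𝓝 ((P[W h | ⨆ n, filtration W φ n]) ω)) := by
    rw [← tendsto_add_atTop_iff_nat 1]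
    exact h2.congr h3
  have h6 : Tendsto (fun i => expansion W φ (ns i) h ω) atTop (𝓝 (W h ω)) :=
    h1.congr fun i => h4 (ns i)
  rwa [← tendsto_nhds_unique (h5.comp hns.tendsto_atTop) h6]

end IsIsonormal

end Isonormal

/-! ### The Wiener integral is isonormal -/

section Wiener

variable {Ω : Type*} [MeasurableSpace Ω] {α β : ℝ} {B : ℝ≥0 → Ω → ℝ} {P : Measure Ω}

theorem IsBifractionalBM.wiener_coe (hB : IsBifractionalBM α β B P)
    (f : StepSpace α β hB.isPosSemidef) :
    hB.wiener (f : HSpace α β hB.isPosSemidef) =ᵐ[P] fun ω =>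
      ∑ t ∈ (StepSpace.coeff f).support,
        StepSpace.coeff f t * B (unitInterval.toNNReal t) ω := by
  have h : hB.wiener (f : HSpace α β hB.isPosSemidef) = hB.combination (StepSpace.coeff f) := by
    change hB.stepIntegral.toContinuousLinearMap.fromCompletion _ = _
    rw [ContinuousLinearMap.fromCompletion_apply_coe]
    rfl
  rw [h, IsBifractionalBM.combination, Finsupp.linearCombination_apply, Finsupp.sum]
  refine (Lp.coeFn_fun_finsetSum _ _).trans ?_
  have h2 : ∀ t ∈ (StepSpace.coeff f).support, ∀ᵐ ω ∂P,
      (StepSpace.coeff f t • hB.toL2 t) ω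
        = StepSpace.coeff f t * B (unitInterval.toNNReal t) ω := by
    intro t _
    filter_upwards [Lp.coeFn_smul (StepSpace.coeff f t) (hB.toL2 t),
      (hB.memLp (unitInterval.toNNReal t)).coeFn_toLp] with ω h3 h4
    rw [h3, Pi.smul_apply, smul_eq_mul, IsBifractionalBM.toL2, h4]
  filter_upwards [(Finset.eventually_all _).2 h2] with ω hω
  exact Finset.sum_congr rfl hω

theorem IsBifractionalBM.hasGaussianLaw_wiener_coe (hB : IsBifractionalBM α β B P)
    (f : StepSpace α β hB.isPosSemidef) :
    HasGaussianLaw (hB.wiener (f : HSpace α β hB.isPosSemidef)) P := by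
  have h : HasGaussianLaw (fun ω => ∑ t ∈ (StepSpace.coeff f).support,
      StepSpace.coeff f t * B (unitInterval.toNNReal t) ω) P :=
    ((hB.isGaussianProcess.comp_right unitInterval.toNNReal).smul
      (StepSpace.coeff f)).hasGaussianLaw_fun_sum
  exact h.congr (hB.wiener_coe f).symm

theorem IsBifractionalBM.integral_wiener_coe (hB : IsBifractionalBM α β B P)
    (f : StepSpace α β hB.isPosSemidef) :
    ∫ ω, hB.wiener (f : HSpace α β hB.isPosSemidef) ω ∂P = 0 := by
  rw [integral_congr_ae (hB.wiener_coe f), integral_finsetSum]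
  · simp [integral_const_mul, hB.centred]
  · exact fun t _ => (hB.isGaussianProcess.hasGaussianLaw_eval _).integrable.const_mul _

/-- Both identities are closed conditions on `h`, so it suffices to check them on the dense image of
`ℰ`, where the integral is a finite combination of the `B(t)`. -/
theorem IsBifractionalBM.isIsonormal_wiener [IsProbabilityMeasure P]
    (hB : IsBifractionalBM α β B P) : IsIsonormal hB.wiener where
  integral_eq h := by
    have hc : Continuous fun X : Lp ℝ 2 P => ∫ ω, ((X ω : ℝ) : ℂ) ∂P :=
      continuous_integral_lipschitz Complex.isometry_ofReal.lipschitz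
    suffices ∫ ω, ((hB.wiener h ω : ℝ) : ℂ) ∂P = 0 by
      rw [integral_complex_ofReal] at this
      exact_mod_cast this
    refine UniformSpace.Completion.induction_on h
      (isClosed_eq (hc.comp hB.wiener.continuous) continuous_const) fun f => ?_
    rw [integral_complex_ofReal, hB.integral_wiener_coe f, Complex.ofReal_zero]
  charFun_eq h := by
    have hlip : LipschitzWith 1 fun x : ℝ => Complex.exp (x * Complex.I) := by
      refine LipschitzWith.of_dist_le_mul fun x y => ?_
      rw [dist_eq_norm, dist_eq_norm, NNReal.coe_one, one_mul]
      have h1 : Complex.exp (x * Complex.I) - Complex.exp (y * Complex.I)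
          = Complex.exp (y * Complex.I) * (Complex.exp (Complex.I * (x - y : ℝ)) - 1) := by
        rw [mul_sub, ← Complex.exp_add, mul_one]
        congr 2
        push_cast
        ring
      rw [h1, norm_mul, Complex.norm_exp_ofReal_mul_I, one_mul]
      exact Real.norm_exp_I_mul_ofReal_sub_one_le
    have hc := continuous_integral_lipschitz (P := P) hlip
    refine UniformSpace.Completion.induction_on h
      (isClosed_eq (hc.comp hB.wiener.continuous) (by fun_prop)) fun f => ?_
    have hG := hB.hasGaussianLaw_wiener_coe f
    have h1 := hG.charFun_map_eq 1
    have hv : Var[hB.wiener (f : HSpace α β hB.isPosSemidef); P]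
        = ‖(f : HSpace α β hB.isPosSemidef)‖ ^ 2 := by
      rw [← covariance_self hG.aemeasurable, covariance]
      simp only [hB.integral_wiener_coe, sub_zero]
      rw [IsIsonormal.integral_mul, real_inner_self_eq_norm_sq]
    rw [charFun_apply_real, integral_map hG.aemeasurable (by fun_prop)] at h1
    simp only [Complex.ofReal_one, one_mul, RCLike.inner_apply, conj_trivial,
      mul_one] at h1
    rw [h1, hB.integral_wiener_coe, hv]
    congr 1
    push_cast
    ring

end Wiener

section Holder

variable {Ω : Type*} [MeasurableSpace Ω] {α β : ℝ} {B : ℝ≥0 → Ω → ℝ} {P : Measure Ω}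

/-! ### Hölder continuity of the sample paths -/

theorem IsBifractionalBM.wiener_ind_sub (hB : IsBifractionalBM α β B P) (s t : I) :
    hB.wiener (ind hB.isPosSemidef t - ind hB.isPosSemidef s)
      =ᵐ[P] fun ω => B (unitInterval.toNNReal t) ω - B (unitInterval.toNNReal s) ω := by
  rw [map_sub]
  filter_upwards [Lp.coeFn_sub (hB.wiener (ind hB.isPosSemidef t))
    (hB.wiener (ind hB.isPosSemidef s)), hB.wiener_ind s, hB.wiener_ind t] with ω h1 h2 h3
  rw [h1, Pi.sub_apply, h2, h3]

/-- The point `j / 2^k` of the unit interval. -/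
def dyadicPoint (k j : ℕ) : I := projIcc 0 1 zero_le_one ((j : ℝ) / 2 ^ k)

theorem abs_dyadicPoint_succ_sub_le (k j : ℕ) :
    |(dyadicPoint k (j + 1) : ℝ) - dyadicPoint k j| ≤ (1 / 2) ^ k := by
  refine (abs_projIcc_sub_projIcc zero_le_one).trans ?_
  rw [← sub_div]
  push_cast
  rw [add_sub_cancel_left, abs_of_pos (by positivity), one_div_pow]

/-- The `q`-th power sum of the dyadic increments, the level `k` being weighted by `2^{kγ}`. -/
def IsBifractionalBM.dyadicSum (hB : IsBifractionalBM α β B P) (γ : ℝ) (q : ℕ) (ω : Ω) : ℝ≥0∞ :=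
  ∑' k : ℕ, ∑ j ∈ Finset.range (2 ^ k), (ENNReal.ofReal (((2 : ℝ) ^ γ) ^ k) *
    ‖hB.wiener (ind hB.isPosSemidef (dyadicPoint k (j + 1))
      - ind hB.isPosSemidef (dyadicPoint k j)) ω‖ₑ) ^ q

theorem IsBifractionalBM.measurable_dyadicSum (hB : IsBifractionalBM α β B P) (γ : ℝ) (q : ℕ) :
    Measurable (hB.dyadicSum γ q) := by
  refine Measurable.tsum fun k => Finset.measurable_fun_sum _ fun j _ => ?_
  exact ((Lp.stronglyMeasurable _).measurable.enorm.const_mul _).pow_const q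

/-- Level `k` has `2^k` increments of `q`-th moment at most `C (2 · 2^{-kαβ})^q`. With the weights
it contributes at most `2^q C ρ^k`, where `ρ = 2^{1 - q(αβ - γ)} < 1`. -/
theorem IsBifractionalBM.lintegral_dyadicSum_lt_top [IsProbabilityMeasure P] (hα : 0 < α)
    (hβ : β ∈ Ioc (0 : ℝ) 1) (hB : IsBifractionalBM α β B P) {γ : ℝ} {q : ℕ}
    (hq : 1 < q * (α * β - γ)) : ∫⁻ ω, hB.dyadicSum γ q ω ∂P < ∞ := by
  have hm : ∀ h, Measurable fun ω => ‖hB.wiener h ω‖ₑ :=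
    fun h => (Lp.stronglyMeasurable _).measurable.enorm
  set C : ℝ≥0∞ := ∫⁻ x, ‖x‖ₑ ^ q ∂(gaussianReal 0 1) with hC
  have hCtop : C < ∞ := IsIsonormal.lintegral_pow_gaussianReal_lt_top q
  set ρ : ℝ := 2 * ((2 : ℝ) ^ γ * (1 / 2) ^ (α * β)) ^ q with hρ
  have hρ0 : 0 ≤ ρ := by positivity
  have hρ1 : ρ < 1 := by
    have h1 : ρ = 2 ^ (1 - q * (α * β - γ)) := by
      have h2 : (2 : ℝ) ^ γ * (1 / 2) ^ (α * β) = 2 ^ (γ - α * β) := by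
        rw [one_div, Real.inv_rpow (by norm_num), Real.rpow_sub (by norm_num), div_eq_mul_inv]
      rw [hρ, h2, ← Real.rpow_natCast, ← Real.rpow_mul (by norm_num)]
      nth_rewrite 1 [← Real.rpow_one 2]
      rw [← Real.rpow_add (by norm_num)]
      congr 1
      ring
    rw [h1]
    exact Real.rpow_lt_one_of_one_lt_of_neg one_lt_two (by linarith)
  have hlevel : ∀ k : ℕ, ∫⁻ ω, ∑ j ∈ Finset.range (2 ^ k), (ENNReal.ofReal (((2 : ℝ) ^ γ) ^ k) *
      ‖hB.wiener (ind hB.isPosSemidef (dyadicPoint k (j + 1))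
        - ind hB.isPosSemidef (dyadicPoint k j)) ω‖ₑ) ^ q ∂P
      ≤ ENNReal.ofReal (2 ^ q * ρ ^ k) * C := by
    intro k
    rw [lintegral_finsetSum _ fun j _ => ((hm _).const_mul _).pow_const q]
    have hterm : ∀ j ∈ Finset.range (2 ^ k), ∫⁻ ω, (ENNReal.ofReal (((2 : ℝ) ^ γ) ^ k) *
        ‖hB.wiener (ind hB.isPosSemidef (dyadicPoint k (j + 1))
          - ind hB.isPosSemidef (dyadicPoint k j)) ω‖ₑ) ^ q ∂P
        ≤ ENNReal.ofReal ((((2 : ℝ) ^ γ) ^ k * (2 * ((1 / 2) ^ (α * β)) ^ k)) ^ q) * C := by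
      intro j _
      simp only [mul_pow (ENNReal.ofReal _)]
      rw [lintegral_const_mul _ ((hm _).pow_const q), hB.isIsonormal_wiener.lintegral_pow,
        ← mul_assoc, ← mul_pow,
        ENNReal.ofReal_pow (p := _ * _) (by positivity),
        ENNReal.ofReal_mul (p := (_ ^ γ) ^ k) (by positivity)]
      gcongr
      rw [← ofReal_norm]
      refine ENNReal.ofReal_le_ofReal ((norm_ind_sub_le hα hβ _ _ _).trans ?_)
      rw [Real.rpow_pow_comm (by norm_num)]
      gcongr
      · exact (mul_pos hα hβ.1).le
      · exact abs_dyadicPoint_succ_sub_le k j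
    refine (Finset.sum_le_card_nsmul _ _ _ hterm).trans (le_of_eq ?_)
    rw [Finset.card_range, nsmul_eq_mul, ← mul_assoc]
    congr 1
    rw [← ENNReal.ofReal_natCast, ← ENNReal.ofReal_mul (by positivity)]
    congr 1
    push_cast
    rw [hρ]
    ring
  have hsum : Summable fun k => 2 ^ q * ρ ^ k :=
    (summable_geometric_of_lt_one hρ0 hρ1).mul_left _
  unfold IsBifractionalBM.dyadicSum
  rw [lintegral_tsum fun k => (Finset.measurable_fun_sum _ fun j _ =>
    ((hm _).const_mul _).pow_const q).aemeasurable]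
  refine (ENNReal.tsum_le_tsum hlevel).trans_lt ?_
  rw [ENNReal.tsum_mul_right, ← ENNReal.ofReal_tsum_of_nonneg (fun k => by positivity) hsum]
  exact ENNReal.mul_lt_top ENNReal.ofReal_lt_top hCtop

/-- The sample paths are `γ`-Hölder continuous for `γ < αβ`, with an integrable constant. -/
theorem IsBifractionalBM.exists_integrable_holder [IsProbabilityMeasure P] (hα : 0 < α)
    (hβ : β ∈ Ioc (0 : ℝ) 1) (hB : IsBifractionalBM α β B P)
    (hcont : ∀ᵐ ω ∂P, Continuous fun t : I => B (unitInterval.toNNReal t) ω)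
    {γ : ℝ} (hγ : 0 < γ) (hγα : γ < α * β) :
    ∃ K : Ω → ℝ, Integrable K P ∧ (∀ ω, 0 ≤ K ω) ∧ ∀ᵐ ω ∂P, ∀ s t : I,
      |B (unitInterval.toNNReal t) ω - B (unitInterval.toNNReal s) ω|
        ≤ K ω * |(t : ℝ) - s| ^ γ := by
  obtain ⟨q, hq⟩ := exists_nat_gt (1 / (α * β - γ))
  have hq' : 1 < q * (α * β - γ) := (div_lt_iff₀ (sub_pos.2 hγα)).1 hq
  have hq0 : q ≠ 0 := by
    rintro rfl
    simp at hq'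
    linarith
  have hfin := hB.lintegral_dyadicSum_lt_top hα hβ hq'
  set A := hB.dyadicSum γ q with hA
  have hAm : Measurable A := hB.measurable_dyadicSum γ q
  have hr1 : (2 : ℝ) ^ (-γ) < 1 := Real.rpow_lt_one_of_one_lt_of_neg one_lt_two (by linarith)
  set c : ℝ := (2 / (1 - 2 ^ (-γ)) + 1) * 2 ^ γ with hc
  have hc0 : 0 ≤ c := by
    have : 0 < 1 - (2 : ℝ) ^ (-γ) := sub_pos.2 hr1
    positivity
  -- Each weighted increment `x` satisfies `x ^ q ≤ A`, and `x ≤ 1 + x ^ q`; using `1 + A` avoids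
  -- the `q`-th root and stays integrable.
  refine ⟨fun ω => c * (1 + (A ω).toReal), ?_, fun ω => by positivity, ?_⟩
  · exact ((integrable_const _).add
      (integrable_toReal_of_lintegral_ne_top hAm.aemeasurable hfin.ne)).const_mul _
  have hinc : ∀ᵐ ω ∂P, ∀ k j : ℕ,
      hB.wiener (ind hB.isPosSemidef (dyadicPoint k (j + 1))
        - ind hB.isPosSemidef (dyadicPoint k j)) ω
      = B (unitInterval.toNNReal (dyadicPoint k (j + 1))) ω
        - B (unitInterval.toNNReal (dyadicPoint k j)) ω :=
    ae_all_iff.2 fun k => ae_all_iff.2 fun j => hB.wiener_ind_sub _ _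
  filter_upwards [hcont, hinc, ae_lt_top hAm hfin.ne] with ω h1 h2 h3 s t
  set f : ℝ → ℝ := IccExtend zero_le_one fun t : I => B (unitInterval.toNNReal t) ω with hf
  have hdy : ∀ k j : ℕ, j < 2 ^ k →
      |f ((j + 1 : ℕ) / 2 ^ k) - f (j / 2 ^ k)| ≤ (1 + (A ω).toReal) * ((2 : ℝ) ^ (-γ)) ^ k := by
    intro k j hj
    -- `IccExtend` evaluates through `projIcc`, as does `dyadicPoint`, so this holds by definition.
    change |B (unitInterval.toNNReal (dyadicPoint k (j + 1))) ω
        - B (unitInterval.toNNReal (dyadicPoint k j)) ω| ≤ _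
    rw [← h2 k j]
    set y : ℝ := hB.wiener (ind hB.isPosSemidef (dyadicPoint k (j + 1))
      - ind hB.isPosSemidef (dyadicPoint k j)) ω with hy
    have h4 : (ENNReal.ofReal (((2 : ℝ) ^ γ) ^ k) * ‖y‖ₑ) ^ q ≤ A ω := by
      refine le_trans ?_ (ENNReal.le_tsum k)
      exact Finset.single_le_sum (f := fun j => (ENNReal.ofReal (((2 : ℝ) ^ γ) ^ k) *
        ‖hB.wiener (ind hB.isPosSemidef (dyadicPoint k (j + 1))
          - ind hB.isPosSemidef (dyadicPoint k j)) ω‖ₑ) ^ q) (fun _ _ => zero_le)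
        (Finset.mem_range.2 hj)
    have h5 := ENNReal.toReal_mono h3.ne h4
    rw [ENNReal.toReal_pow, ENNReal.toReal_mul, ENNReal.toReal_ofReal (by positivity),
      toReal_enorm, Real.norm_eq_abs] at h5
    have h6 : ((2 : ℝ) ^ γ) ^ k * |y| ≤ 1 + (A ω).toReal := by
      rcases le_total (((2 : ℝ) ^ γ) ^ k * |y|) 1 with h | h
      · linarith [ENNReal.toReal_nonneg (a := A ω)]
      · linarith [le_self_pow₀ h hq0]
    rw [Real.rpow_neg (by norm_num), inv_pow, ← div_eq_mul_inv, le_div_iff₀ (by positivity)]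
    linarith
  have := holder_of_dyadic hγ (A := 1 + (A ω).toReal) (by positivity) h1.Icc_extend' hdy s.2 t.2
  simpa only [hf, IccExtend_val] using this

/-! ### Uniform Hölder bounds for the partial sums -/

theorem continuous_ind (hα : 0 < α) (hβ : β ∈ Ioc (0 : ℝ) 1) (hR : IsPosSemidef α β) :
    Continuous (ind hR) := by
  have hαβ : 0 < α * β := mul_pos hα hβ.1
  refine continuous_iff_continuousAt.2 fun s => tendsto_iff_norm_sub_tendsto_zero.2 ?_
  have h : Tendsto (fun t : I => 2 * |(t : ℝ) - s| ^ (α * β)) (𝓝 s) (𝓝 0) := by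
    have hc : Continuous fun t : I => 2 * |(t : ℝ) - s| ^ (α * β) :=
      continuous_const.mul ((by fun_prop : Continuous fun t : I => |(t : ℝ) - s|).rpow_const
        fun _ => Or.inr hαβ.le)
    simpa [Real.zero_rpow hαβ.ne'] using hc.tendsto s
  exact squeeze_zero (fun _ => norm_nonneg _) (fun t => norm_ind_sub_le hα hβ hR s t) h

theorem IsBifractionalBM.continuous_partialSum (hα : 0 < α) (hβ : β ∈ Ioc (0 : ℝ) 1)
    (hB : IsBifractionalBM α β B P) (φ : ℕ → HSpace α β hB.isPosSemidef) (N : ℕ) (ω : Ω) :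
    Continuous (hB.partialSum φ N ω) :=
  continuous_finsetSum _ fun _ _ =>
    (continuous_const.inner (continuous_ind hα hβ hB.isPosSemidef)).mul continuous_const

/-- The inequality is closed in `(s, t)`, and exchanging `s` and `t` turns the one-sided bound into
a bound on the absolute value. -/
theorem holder_of_dense {γ M : ℝ} (hγ : 0 < γ) {g : I → ℝ} (hg : Continuous g) {D : Set I}
    (hD : Dense D) (h : ∀ s ∈ D, ∀ t ∈ D, g t - g s ≤ M * |(t : ℝ) - s| ^ γ) (s t : I) :
    |g t - g s| ≤ M * |(t : ℝ) - s| ^ γ := by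
  have hcl : IsClosed {z : I × I | g z.2 - g z.1 ≤ M * |(z.2 : ℝ) - z.1| ^ γ} :=
    isClosed_le ((hg.comp continuous_snd).sub (hg.comp continuous_fst))
      (continuous_const.mul ((by fun_prop : Continuous fun z : I × I =>
        |(z.2 : ℝ) - z.1|).rpow_const fun _ => Or.inr hγ.le))
  have hall : ∀ s t, g t - g s ≤ M * |(t : ℝ) - s| ^ γ := fun s t =>
    hcl.closure_subset_iff.2 (fun z hz => h z.1 hz.1 z.2 hz.2) ((hD.prod hD) (s, t))
  refine abs_sub_le_iff.2 ⟨hall s t, ?_⟩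
  rw [abs_sub_comm (t : ℝ)]
  exact hall t s

/-- Conditional expectation is monotone, so the Hölder bound of the paths passes to the partial sums
with constant `P[K | ℱ N]`, a convergent and hence bounded sequence. -/
theorem IsBifractionalBM.exists_partialSum_holder [IsProbabilityMeasure P] (hα : 0 < α)
    (hβ : β ∈ Ioc (0 : ℝ) 1) (hB : IsBifractionalBM α β B P)
    {φ : ℕ → HSpace α β hB.isPosSemidef} (hφ : Orthonormal ℝ φ) {γ : ℝ} (hγ : 0 < γ)
    {K : Ω → ℝ} (hKint : Integrable K P) (hK0 : ∀ ω, 0 ≤ K ω) (hK : ∀ᵐ ω ∂P, ∀ s t : I,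
      |B (unitInterval.toNNReal t) ω - B (unitInterval.toNNReal s) ω|
        ≤ K ω * |(t : ℝ) - s| ^ γ) :
    ∀ᵐ ω ∂P, ∃ M, 0 ≤ M ∧ ∀ N, ∀ s t : I,
      |hB.partialSum φ N ω t - hB.partialSum φ N ω s| ≤ M * |(t : ℝ) - s| ^ γ := by
  obtain ⟨D, hDc, hD⟩ := TopologicalSpace.exists_countable_dense I
  have hW := hB.isIsonormal_wiener
  set ℱ := IsIsonormal.filtration hB.wiener φ with hℱ
  have hle : ∀ N (s t : I), ∀ᵐ ω ∂P, hB.partialSum φ (N + 1) ω t - hB.partialSum φ (N + 1) ω s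
      ≤ |(t : ℝ) - s| ^ γ * (P[K | ℱ N]) ω := by
    intro N s t
    have hmono : hB.wiener (ind hB.isPosSemidef t - ind hB.isPosSemidef s)
        ≤ᵐ[P] (|(t : ℝ) - s| ^ γ) • K := by
      filter_upwards [hB.wiener_ind_sub s t, hK] with ω h1 h2
      rw [h1, Pi.smul_apply, smul_eq_mul, mul_comm]
      exact (le_abs_self _).trans (h2 s t)
    have h1 := condExp_mono (m := ℱ N) ((Lp.memLp (hB.wiener (ind hB.isPosSemidef t
      - ind hB.isPosSemidef s))).integrable (by norm_num)) (hKint.smul (|(t : ℝ) - s| ^ γ)) hmono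
    filter_upwards [h1, condExp_smul (|(t : ℝ) - s| ^ γ) K (ℱ N) (μ := P),
      hW.condExp_eq_expansion hφ (ind hB.isPosSemidef t - ind hB.isPosSemidef s) N]
      with ω h1 h2 h3
    rw [h3, h2, IsIsonormal.expansion_sub] at h1
    exact h1
  have hnn : ∀ᵐ ω ∂P, ∀ N, 0 ≤ (P[K | ℱ N]) ω :=
    ae_all_iff.2 fun N => condExp_nonneg (Eventually.of_forall hK0)
  -- The exceptional null set depends on `s`, `t` and `N`; countability of `D` leaves a single one.
  have hall : ∀ᵐ ω ∂P, ∀ N, ∀ s ∈ D, ∀ t ∈ D,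
      hB.partialSum φ (N + 1) ω t - hB.partialSum φ (N + 1) ω s
        ≤ |(t : ℝ) - s| ^ γ * (P[K | ℱ N]) ω :=
    ae_all_iff.2 fun N => (ae_ball_iff hDc).2 fun s _ => (ae_ball_iff hDc).2 fun t _ => hle N s t
  filter_upwards [hall, hnn, MeasureTheory.tendsto_ae_condExp (μ := P) (ℱ := ℱ) K]
    with ω h1 h2 h3
  obtain ⟨M, hM⟩ := h3.bddAbove_range
  have hM' : ∀ N, (P[K | ℱ N]) ω ≤ M := fun N => hM (mem_range_self N)
  have hM0 : 0 ≤ M := (h2 0).trans (hM' 0)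
  refine ⟨M, hM0, fun N s t => ?_⟩
  -- The empty sum is not one of the conditional expectations, which start with one term.
  rcases N with _ | N
  · simp only [IsBifractionalBM.partialSum, Finset.range_zero, Finset.sum_empty, sub_self,
      abs_zero]
    positivity
  · refine holder_of_dense hγ (hB.continuous_partialSum hα hβ φ (N + 1) ω) hD
      (fun s hs t ht => (h1 N s hs t ht).trans ?_) s t
    rw [mul_comm]
    exact mul_le_mul_of_nonneg_right (hM' N) (by positivity)

/-- Convergence of the partial sums for all orders of regularity smaller than `γ < αβ`. -/
theorem IsBifractionalBM.tendstoBesov_of_lt [IsProbabilityMeasure P] (hα : 0 < α)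
    (hβ : β ∈ Ioc (0 : ℝ) 1) (hB : IsBifractionalBM α β B P)
    (hcont : ∀ᵐ ω ∂P, Continuous fun t : I => B (unitInterval.toNNReal t) ω)
    (φ : HilbertBasis ℕ ℝ (HSpace α β hB.isPosSemidef)) {γ : ℝ} (hγ : 0 < γ)
    (hγα : γ < α * β) :
    ∀ᵐ ω ∂P, ∀ γ' p : ℝ, 0 < γ' → γ' < γ → TendstoBesov γ' p
      (fun N => hB.partialSum φ N ω) (fun t : I => B (unitInterval.toNNReal t) ω) := by
  obtain ⟨K, hKint, hK0, hK⟩ := hB.exists_integrable_holder hα hβ hcont hγ hγα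
  obtain ⟨D, hDc, hD⟩ := TopologicalSpace.exists_countable_dense I
  have hlim : ∀ᵐ ω ∂P, ∀ t ∈ D, Tendsto (fun N => hB.partialSum φ N ω t) atTop
      (𝓝 (B (unitInterval.toNNReal t) ω)) := by
    refine (ae_ball_iff hDc).2 fun t _ => ?_
    filter_upwards [hB.isIsonormal_wiener.tendsto_expansion φ (ind hB.isPosSemidef t),
      hB.wiener_ind t] with ω h1 h2
    rw [← h2]
    exact h1
  filter_upwards [hK, hlim, hB.exists_partialSum_holder hα hβ φ.orthonormal hγ hKint hK0 hK]
    with ω h1 h2 ⟨M, hM0, hM⟩ γ' p hγ' hγγ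
  refine ⟨fun N => ?_, ?_, ?_⟩
  · exact memBesov_of_holder hγ' hM0 (holder_mono hγ'.le hγγ.le hM0 fun x y => hM N y x)
  · exact memBesov_of_holder hγ' (hK0 ω)
      (holder_mono hγ'.le hγγ.le (hK0 ω) fun x y => h1 y x)
  · refine tendsto_besovNorm_zero hγ' hγγ (add_nonneg hM0 (hK0 ω)) hD (fun N x y => ?_)
      fun t ht => ?_
    · have h3 := abs_sub (hB.partialSum φ N ω x - hB.partialSum φ N ω y)
        (B (unitInterval.toNNReal x) ω - B (unitInterval.toNNReal y) ω)
      rw [sub_sub_sub_comm, add_mul]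
      exact h3.trans (add_le_add (hM N y x) (h1 y x))
    · simpa using (h2 t ht).sub_const (B (unitInterval.toNNReal t) ω)

end Holder

end BifractionalBM

end

/-! ### One null set for all orders of regularity -/

theorem theorem4p1 {Ω : Type*} [MeasurableSpace Ω] (P : Measure Ω) [IsProbabilityMeasure P]
    (α β : ℝ) (hα : α ∈ Ioo (0 : ℝ) 1) (hβ : β ∈ Ioc (0 : ℝ) 1) (hαβ : 1 / 2 < α * β)
    (B : ℝ≥0 → Ω → ℝ) (hB : BifractionalBM.IsBifractionalBM α β B P)
    (hcont : ∀ᵐ ω ∂P, Continuous fun t : I => B (unitInterval.toNNReal t) ω)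
    (φ : HilbertBasis ℕ ℝ (BifractionalBM.HSpace α β hB.isPosSemidef)) :
    ∀ᵐ ω ∂P, ∀ ε p : ℝ, 0 < ε → 1 ≤ p → 1 / 2 < α * β - ε - 1 / p →
      BifractionalBM.TendstoBesov (α * β - ε) p
        (fun N => hB.partialSum φ N ω) (fun t : I => B (unitInterval.toNNReal t) ω) := by
  have hpos : 0 < α * β := by linarith
  -- Countably many orders increasing to `αβ` suffice for all `ε`; the shift by `2` keeps them
  -- positive from `n = 0` on.
  have hstep : ∀ n : ℕ, ∀ᵐ ω ∂P, ∀ γ' p : ℝ, 0 < γ' → γ' < α * β * (1 - 1 / ((n : ℝ) + 2)) →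
      BifractionalBM.TendstoBesov γ' p
        (fun N => hB.partialSum φ N ω) (fun t : I => B (unitInterval.toNNReal t) ω) := by
    intro n
    have h1 : 0 < 1 / ((n : ℝ) + 2) := by positivity
    have h2 : 1 / ((n : ℝ) + 2) < 1 := by
      rw [div_lt_one (by positivity)]
      linarith [(Nat.cast_nonneg n : (0 : ℝ) ≤ n)]
    exact hB.tendstoBesov_of_lt hα.1 hβ hcont φ (mul_pos hpos (by linarith))
      (mul_lt_of_lt_one_right hpos (by linarith))
  filter_upwards [ae_all_iff.2 hstep] with ω hω ε p hε hp hεp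
  obtain ⟨n, hn⟩ := exists_nat_one_div_lt (div_pos hε hpos)
  have hp' : 0 < 1 / p := by positivity
  refine hω n _ p (by linarith) ?_
  have h3 : 1 / ((n : ℝ) + 2) < ε / (α * β) :=
    (one_div_le_one_div_of_le (by positivity) (by linarith)).trans_lt hn
  have h4 := mul_lt_mul_of_pos_left h3 hpos
  rw [mul_div_cancel₀ _ hpos.ne'] at h4
  linarith
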